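/- Let $F$ be a Ferrers shape in French notation (straight left and bottom sides, descending staircase as upper-right boundary), whose cells are filled with arbitrary non-negative integers. Label the corners of the cells by partitions as follows. All corners along the left side and the bottom side of $F$ are labelled by the empty partition. If the lower-left, lower-right and upper-left corners of a cell with entry $m$ are labelled by $\rho,\mu,\nu$, then its upper-right corner is labelled by the partition $\lambda$ given by the RSK forward rule $$\lambda_1=\max\{\mu_1,\nu_1\}+m,\qquad \lambda_{i+1}=\max\{\mu_{i+1},\nu_{i+1}\}+\min\{\mu_i,\nu_i\}-\rho_i\quad(i\ge1),$$ where partitions are continued by zeros. A NE-chain is a (possibly empty) sequence of non-zero entries, in distinct cells, each of which is weakly above and weakly to the right of the preceding one; its length is the sum of its entries. A se-chain is a (possibly empty) sequence of non-zero entries each of which is strictly below and strictly to the right of the preceding one; its length is the number of its entries. Let $c$ be a corner of $F$, let $\lambda=(\lambda_1,\lambda_2,\dots)$ be its label, let $\lambda'$ be the partition conjugate to $\lambda$, and consider only chains situated in the rectangular region to the left and below of $c$. Then: 1. For every $k\ge 0$, the maximal sum of all the entries in a collection of $k$ pairwise disjoint NE-chains is equal to $\lambda_1+\lambda_2+\dots+\lambda_k$.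 2. For every $k\ge 0$, the maximal cardinality of the multiset union of $k$ se-chains (not necessarily distinct), such that each cell with entry $e$ belongs to at most $e$ of these chains, is equal to $\lambda'_1+\lambda'_2+\dots+\lambda'_k$. In particular, $\lambda_1$ is the length of the longest NE-chain, and $\lambda'_1$ is the length of the longest se-chain. -/

import Mathlib

/-! Conventions. A Ferrers shape in French notation is a `YoungDiagram` `F`: the pair `(i, j) ∈ F`
is the cell in row `i` (counted from the bottom) and column `j` (counted from the left), both
starting at `0`.  The pair `(a, b)` also names the lattice point at height `a` and abscissa `b`, so
that the cell `(i, j)` has the lower-left corner `(i, j)` and the upper-right corner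
`(i + 1, j + 1)`.  A partition is a `YoungDiagram` too: `lam.rowLen i` is the part with (1-based)
number `i + 1`, and `lam.transpose` is the conjugate partition. -/

/-- The cells of the rectangular region to the left of and below the lattice point `(a, b)`. -/
def cornerRect (a b : ℕ) : Finset (ℕ × ℕ) := Finset.range a ×ˢ Finset.range b

/-- `(a, b)` is a corner of (a cell of, or a point on the left or bottom side of) the shape `F`:
the rectangle to the left of and below it lies in `F`. -/
def IsShapeCorner (F : YoungDiagram) (a b : ℕ) : Prop := ∀ p ∈ cornerRect a b, p ∈ F

/-- The successive values of CARRY in the RSK forward rule for a cell with entry `m`: first `m`,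
then `min (μ_i, ν_i) - ρ_i` (here `ρ` is contained in `μ` and in `ν`, so that the
difference is not truncated). -/
def rskCarry (m : ℕ) (ρ μ ν : YoungDiagram) : ℕ → ℕ
  | 0 => m
  | i + 1 => min (μ.rowLen i) (ν.rowLen i) - ρ.rowLen i

/-- The RSK forward rule: `lam` is the output for a cell with entry `m` whose lower-left,
lower-right and upper-left corners are labelled by `ρ`, `μ`, `ν`. -/
def RSKRule (m : ℕ) (ρ μ ν lam : YoungDiagram) : Prop :=
  ∀ i : ℕ, lam.rowLen i = max (μ.rowLen i) (ν.rowLen i) + rskCarry m ρ μ ν i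

/-- The labelling `Λ` of the corners of `F` by partitions is the one that is obtained from the
filling `f` by RSK, starting from empty partitions along the left and the bottom side. (Values of
`f` outside `F`, and of `Λ` at points which are not corners of `F`, play no role.) -/
structure IsRSKDiagram (F : YoungDiagram) (f : ℕ × ℕ → ℕ) (Λ : ℕ → ℕ → YoungDiagram) :
    Prop where
  left : ∀ a, Λ a 0 = ⊥
  bottom : ∀ b, Λ 0 b = ⊥
  cell : ∀ i j, (i, j) ∈ F →
    RSKRule (f (i, j)) (Λ i j) (Λ i (j + 1)) (Λ (i + 1) j) (Λ (i + 1) (j + 1))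

/-- A NE-chain of the filling `f` (given by its set of cells; possibly empty): non-zero entries such
that, of any two, one is weakly above and weakly to the right of the other. -/
def IsNEChain (f : ℕ × ℕ → ℕ) (C : Finset (ℕ × ℕ)) : Prop :=
  (∀ p ∈ C, f p ≠ 0) ∧ IsChain (fun p q : ℕ × ℕ => p.1 ≤ q.1 ∧ p.2 ≤ q.2) (C : Set (ℕ × ℕ))

/-- A se-chain of the filling `f` (given by its set of cells; possibly empty): non-zero entries such
that, of any two distinct ones, one is strictly below and strictly to the right of the other. -/
def IsSeChain (f : ℕ × ℕ → ℕ) (C : Finset (ℕ × ℕ)) : Prop :=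
  (∀ p ∈ C, f p ≠ 0) ∧ IsChain (fun p q : ℕ × ℕ => q.1 < p.1 ∧ p.2 < q.2) (C : Set (ℕ × ℕ))

/-- The total sums of all entries in `k` pairwise disjoint NE-chains inside `cornerRect a b`. -/
def neTotals (f : ℕ × ℕ → ℕ) (a b k : ℕ) : Set ℕ :=
  {n | ∃ C : Fin k → Finset (ℕ × ℕ),
    (∀ t, IsNEChain f (C t) ∧ C t ⊆ cornerRect a b) ∧
    (∀ s t, s ≠ t → Disjoint (C s) (C t)) ∧
    n = ∑ t, ∑ p ∈ C t, f p}

/-- The cardinalities of the multiset unions of `k` se-chains inside `cornerRect a b`, where no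
cell `p` belongs to more than `f p` of the chains. -/
def seTotals (f : ℕ × ℕ → ℕ) (a b k : ℕ) : Set ℕ :=
  {n | ∃ C : Fin k → Finset (ℕ × ℕ),
    (∀ t, IsSeChain f (C t) ∧ C t ⊆ cornerRect a b) ∧
    (∀ p, (Finset.univ.filter fun t => p ∈ C t).card ≤ f p) ∧
    n = ∑ t, (C t).card}

/-! Write each row of the filling, from the bottom up, as a weakly increasing word of column
indices, each repeated as often as its entry says. In the concatenated word, weakly increasing
subwords come from NE-chains and strictly decreasing ones from se-chains. The labels `Λ i 0, …, Λ i
b` at height `i` form a chain of horizontal strips, that is, a semistandard tableau, and the forward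
rule says that the tableau at height `i + 1` arises from the one below by row insertion of the word
of row `i`: the carry into a row counts the letters bumped from the preceding row
(`IsRSKDiagram.knuthReach_row`). Hence the reading word of the tableau at height `a` is turned into
the word of the filling by elementary Knuth transformations (`IsRSKDiagram.knuthReach_filling`).

Lower bounds: in the tableau word the first `k` rows are weakly increasing subwords and the first
`k` columns strictly decreasing ones, of the required total lengths. Knuth transformations preserve
the existence of `k` disjoint chains of given total length (`HasChains.le_of_step`,
`HasChains.gt_of_step`).

Upper bounds: these need no transport in the opposite direction. A NE-chain and a se-chain share at
most one cell, so totals `n` for `k` NE-chains and `m` for `l` se-chains satisfy `n + m ≤ |f| + k *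
l`, where `|f|` is the sum of the entries in the rectangle (`neTotal_add_seTotal_le`). When the
first `k` rows and the first `l` columns cover the diagram of `λ` and overlap in a full `k × l`
rectangle, the two lower bounds add up to exactly the right-hand side. For each `k` there is such an
`l`, and conversely, so both lower bounds are sharp. -/

/-! ### Coloured words and elementary Knuth transformations -/

/-- A word with coloured letters, given as a list of pairs `(letter, colour)`, in which the
subword of each colour below `k` is a chain for `r`. -/
def IsColoring (r : ℕ → ℕ → Prop) (k : ℕ) (L : List (ℕ × ℕ)) : Prop :=
  L.Pairwise fun p q => p.2 = q.2 → p.2 < k → r p.1 q.1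

/-- The word `w` has `k` disjoint subwords, each of them a chain for `r`, of total length at
least `N`. -/
def HasChains (r : ℕ → ℕ → Prop) (k : ℕ) (w : List ℕ) (N : ℕ) : Prop :=
  ∃ L : List (ℕ × ℕ), IsColoring r k L ∧ L.map Prod.fst = w ∧ N ≤ L.countP (fun p => p.2 < k)

/-- Elementary Knuth transformations, in the direction that undoes row insertion. -/
inductive KnuthStep : List ℕ → List ℕ → Prop
  | first (u v : List ℕ) {x y z : ℕ} (hxy : x < y) (hyz : y ≤ z) :
      KnuthStep (u ++ y :: x :: z :: v) (u ++ y :: z :: x :: v)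
  | second (u v : List ℕ) {x y z : ℕ} (hxy : x ≤ y) (hyz : y < z) :
      KnuthStep (u ++ z :: x :: y :: v) (u ++ x :: z :: y :: v)

/-- Reachability by elementary Knuth transformations. -/
abbrev KnuthReach : List ℕ → List ℕ → Prop := Relation.ReflTransGen KnuthStep

/-- Two chains may exchange their tails after a cut, provided that every letter before the cut is
compatible with the tail it now precedes. This is the repair needed when a Knuth transformation
breaks a chain. -/
theorem IsColoring.append_map_swap {r : ℕ → ℕ → Prop} {k s t : ℕ} {U V : List (ℕ × ℕ)}
    (hs : s < k) (ht : t < k) (hU : IsColoring r k U) (hV : IsColoring r k V)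
    (hUV : ∀ p ∈ U, ∀ q ∈ V, p.2 = Equiv.swap s t q.2 → p.2 < k → r p.1 q.1) :
    IsColoring r k (U ++ V.map (Prod.map id (Equiv.swap s t))) := by
  have hk : ∀ c, Equiv.swap s t c < k ↔ c < k := by
    intro c
    rw [Equiv.swap_apply_def]
    split_ifs <;> omega
  refine List.pairwise_append.2 ⟨hU, ?_, ?_⟩
  · refine List.pairwise_map.2 (List.Pairwise.imp ?_ hV)
    intro p q h h1 h2
    exact h ((Equiv.swap s t).injective h1) ((hk _).1 h2)
  · intro p hp q hq
    obtain ⟨q', hq', rfl⟩ := List.mem_map.1 hq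
    exact hUV p hp q' hq'

theorem countP_map_swap {k s t : ℕ} (hs : s < k) (ht : t < k) (V : List (ℕ × ℕ)) :
    (V.map (Prod.map id (Equiv.swap s t))).countP (fun p => p.2 < k) =
      V.countP (fun p => p.2 < k) := by
  rw [List.countP_map]
  congr 1
  funext p
  have : Equiv.swap s t p.2 < k ↔ p.2 < k := by
    rw [Equiv.swap_apply_def]
    split_ifs <;> omega
  simp [this]

theorem map_fst_eq_append_cons₃ {L : List (ℕ × ℕ)} {u v : List ℕ} {x y z : ℕ}
    (h : L.map Prod.fst = u ++ x :: y :: z :: v) :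
    ∃ U V a b c, L = U ++ (x, a) :: (y, b) :: (z, c) :: V ∧ U.map Prod.fst = u ∧
      V.map Prod.fst = v := by
  obtain ⟨U, L1, rfl, hU, h1⟩ := List.map_eq_append_iff.1 h
  obtain ⟨⟨x, a⟩, L2, rfl, rfl, h2⟩ := List.map_eq_cons_iff.1 h1
  obtain ⟨⟨y, b⟩, L3, rfl, rfl, h3⟩ := List.map_eq_cons_iff.1 h2
  obtain ⟨⟨z, c⟩, V, rfl, rfl, h4⟩ := List.map_eq_cons_iff.1 h3
  exact ⟨U, V, a, b, c, rfl, hU, h4⟩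

/-- The colours travel with the letters unless `y x z` becomes `y z x` with `x` and `z` in one
chain. Then `y`, being larger than `x`, is not in that chain, and `y z` can replace `x z`. -/
theorem HasChains.le_of_step {k N : ℕ} {w w' : List ℕ} (h : HasChains (· ≤ ·) k w N)
    (hw : KnuthStep w w') : HasChains (· ≤ ·) k w' N := by
  obtain ⟨L, hL, hLw, hN⟩ := h
  cases hw with
  | @first u v x y z hxy hyz =>
    obtain ⟨U, V, a, b, c, rfl, rfl, rfl⟩ := map_fst_eq_append_cons₃ hLw
    simp only [IsColoring, List.pairwise_append, List.pairwise_cons, List.mem_cons,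
      forall_eq_or_imp] at hL
    obtain ⟨hU, ⟨⟨h1, h2, h3⟩, ⟨h4, h5⟩, h6, hV⟩, hX⟩ := hL
    by_cases hbc : b = c ∧ b < k
    · obtain ⟨rfl, hb⟩ := hbc
      by_cases ha : a < k
      -- The chain through `y` now takes `z` and the old tail of `z`; the chain through `x` takes
      -- the old tail of `y`, whose letters are at least `y > x`.
      · refine ⟨(U ++ [(y, a), (z, a), (x, b)]) ++ V.map (Prod.map id (Equiv.swap a b)),
          IsColoring.append_map_swap ha hb ?_ hV ?_, by simp, ?_⟩
        · simp only [IsColoring, List.pairwise_append, List.pairwise_cons, List.mem_cons,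
            forall_eq_or_imp]
          grind
        · intro p hp q hq
          rw [Equiv.swap_apply_def]
          simp only [List.mem_append, List.mem_cons, List.not_mem_nil, or_false] at hp
          have := h3 q hq
          have := h6 q hq
          rcases hp with hp | rfl | rfl | rfl
          · have := hX p hp
            grind
          all_goals grind
        · simp only [List.countP_append, List.countP_cons, countP_map_swap ha hb] at hN ⊢
          simp only [ha, hb] at hN ⊢
          simp at hN ⊢
          omega
      -- Here `y` is in no chain: it takes the place of `x`, which becomes the unused letter.
      · refine ⟨U ++ (y, b) :: (z, b) :: (x, a) :: V, ?_, by simp, ?_⟩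
        · simp only [IsColoring, List.pairwise_append, List.pairwise_cons, List.mem_cons,
            forall_eq_or_imp]
          grind
        · simp only [List.countP_append, List.countP_cons] at hN ⊢
          simp only [ha, hb] at hN ⊢
          simp at hN ⊢
          omega
    · refine ⟨U ++ (y, a) :: (z, c) :: (x, b) :: V, ?_, by simp, ?_⟩
      · simp only [IsColoring, List.pairwise_append, List.pairwise_cons, List.mem_cons,
          forall_eq_or_imp]
        grind
      · simp only [List.countP_append, List.countP_cons] at hN ⊢
        omega
  | @second u v x y z hxy hyz =>
    obtain ⟨U, V, a, b, c, rfl, rfl, rfl⟩ := map_fst_eq_append_cons₃ hLw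
    simp only [IsColoring, List.pairwise_append, List.pairwise_cons, List.mem_cons,
      forall_eq_or_imp] at hL
    refine ⟨U ++ (x, b) :: (z, a) :: (y, c) :: V, ?_, by simp, ?_⟩
    · simp only [IsColoring, List.pairwise_append, List.pairwise_cons, List.mem_cons,
        forall_eq_or_imp]
      grind
    · simp only [List.countP_append, List.countP_cons] at hN ⊢
      omega

/-- The dual argument: only `z x y` becoming `x z y` with `z` and `x` in one chain does harm. Since
`x ≤ y`, the letter `y` is not in that chain, and `z y` replaces `z x`. -/
theorem HasChains.gt_of_step {k N : ℕ} {w w' : List ℕ} (h : HasChains (· > ·) k w N)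
    (hw : KnuthStep w w') : HasChains (· > ·) k w' N := by
  obtain ⟨L, hL, hLw, hN⟩ := h
  cases hw with
  | @first u v x y z hxy hyz =>
    obtain ⟨U, V, a, b, c, rfl, rfl, rfl⟩ := map_fst_eq_append_cons₃ hLw
    simp only [IsColoring, List.pairwise_append, List.pairwise_cons, List.mem_cons,
      forall_eq_or_imp] at hL
    refine ⟨U ++ (y, a) :: (z, c) :: (x, b) :: V, ?_, by simp, ?_⟩
    · simp only [IsColoring, List.pairwise_append, List.pairwise_cons, List.mem_cons,
        forall_eq_or_imp]
      grind
    · simp only [List.countP_append, List.countP_cons] at hN ⊢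
      omega
  | @second u v x y z hxy hyz =>
    obtain ⟨U, V, a, b, c, rfl, rfl, rfl⟩ := map_fst_eq_append_cons₃ hLw
    simp only [IsColoring, List.pairwise_append, List.pairwise_cons, List.mem_cons,
      forall_eq_or_imp] at hL
    obtain ⟨hU, ⟨⟨h1, h2, h3⟩, ⟨h4, h5⟩, h6, hV⟩, hX⟩ := hL
    by_cases hab : a = b ∧ a < k
    · obtain ⟨rfl, ha⟩ := hab
      by_cases hc : c < k
      · refine ⟨(U ++ [(x, c), (z, a), (y, a)]) ++ V.map (Prod.map id (Equiv.swap a c)),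
          IsColoring.append_map_swap ha hc ?_ hV ?_, by simp, ?_⟩
        · simp only [IsColoring, List.pairwise_append, List.pairwise_cons, List.mem_cons,
            forall_eq_or_imp]
          grind
        · intro p hp q hq
          rw [Equiv.swap_apply_def]
          simp only [List.mem_append, List.mem_cons, List.not_mem_nil, or_false] at hp
          have := h3 q hq
          have := h5 q hq
          have := h6 q hq
          rcases hp with hp | rfl | rfl | rfl
          · have := hX p hp
            grind
          all_goals grind
        · simp only [List.countP_append, List.countP_cons, countP_map_swap ha hc] at hN ⊢
          simp only [ha, hc] at hN ⊢
          simp at hN ⊢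
          omega
      · refine ⟨U ++ (x, c) :: (z, a) :: (y, a) :: V, ?_, by simp, ?_⟩
        · simp only [IsColoring, List.pairwise_append, List.pairwise_cons, List.mem_cons,
            forall_eq_or_imp]
          grind
        · simp only [List.countP_append, List.countP_cons] at hN ⊢
          simp only [ha, hc] at hN ⊢
          simp at hN ⊢
          omega
    · refine ⟨U ++ (x, b) :: (z, a) :: (y, c) :: V, ?_, by simp, ?_⟩
      · simp only [IsColoring, List.pairwise_append, List.pairwise_cons, List.mem_cons,
          forall_eq_or_imp]
        grind
      · simp only [List.countP_append, List.countP_cons] at hN ⊢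
        omega

theorem HasChains.le_of_reach {k N : ℕ} {w w' : List ℕ} (h : HasChains (· ≤ ·) k w N)
    (hw : KnuthReach w w') : HasChains (· ≤ ·) k w' N := by
  induction hw with
  | refl => exact h
  | tail _ hs ih => exact ih.le_of_step hs

theorem HasChains.gt_of_reach {k N : ℕ} {w w' : List ℕ} (h : HasChains (· > ·) k w N)
    (hw : KnuthReach w w') : HasChains (· > ·) k w' N := by
  induction hw with
  | refl => exact h
  | tail _ hs ih => exact ih.gt_of_step hs

theorem KnuthReach.length_eq {w w' : List ℕ} (hw : KnuthReach w w') : w.length = w'.length := by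
  induction hw with
  | refl => rfl
  | tail _ hs ih => cases hs <;> simpa using ih

theorem KnuthStep.context {w w' : List ℕ} (hw : KnuthStep w w') (u v : List ℕ) :
    KnuthStep (u ++ w ++ v) (u ++ w' ++ v) := by
  cases hw with
  | first u' v' hxy hyz => simpa using KnuthStep.first (u ++ u') (v' ++ v) hxy hyz
  | second u' v' hxy hyz => simpa using KnuthStep.second (u ++ u') (v' ++ v) hxy hyz

theorem KnuthReach.context {w w' : List ℕ} (hw : KnuthReach w w') (u v : List ℕ) :
    KnuthReach (u ++ w ++ v) (u ++ w' ++ v) := by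
  induction hw with
  | refl => exact .refl
  | tail _ hs ih => exact ih.tail (hs.context u v)

theorem KnuthReach.append_left {w w' : List ℕ} (hw : KnuthReach w w') (u : List ℕ) :
    KnuthReach (u ++ w) (u ++ w') := by
  simpa using hw.context u []

theorem KnuthReach.append_right {w w' : List ℕ} (hw : KnuthReach w w') (v : List ℕ) :
    KnuthReach (w ++ v) (w' ++ v) := by
  simpa using hw.context [] v

/-! ### Insertion of a single letter into a row -/

/-- The letter `z` passes each letter of `A` in turn, the next letter to the right serving as the
witness of the transformation; for the last one the witness is `x`. -/
theorem knuthReach_shift_bumped {x z : ℕ} (hxz : x < z) {A : List ℕ} (hA : A.Pairwise (· ≤ ·))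
    (hAx : ∀ a ∈ A, a ≤ x) (v : List ℕ) :
    KnuthReach (z :: (A ++ x :: v)) (A ++ z :: x :: v) := by
  induction A with
  | nil => exact .refl
  | cons a A ih =>
    rw [List.pairwise_cons] at hA
    have h2 := (ih hA.2 (fun b hb => hAx b (by simp [hb]))).append_left [a]
    refine Relation.ReflTransGen.head ?_ (by simpa using h2)
    cases A with
    | nil => simpa using KnuthStep.second [] v (hAx a (by simp)) hxz
    | cons b A =>
      have hb : b < z := lt_of_le_of_lt (hAx b (by simp)) hxz
      simpa using KnuthStep.second [] (A ++ x :: v) (hA.1 b (by simp)) hb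

/-- The letter `x` moves right through `B`, the letter just before it serving as the witness. -/
theorem knuthReach_shift_inserted {x z : ℕ} (hxz : x < z) {B : List ℕ}
    (hB : (z :: B).Pairwise (· ≤ ·)) :
    KnuthReach (z :: x :: B) (z :: (B ++ [x])) := by
  induction B generalizing z with
  | nil => exact .refl
  | cons b B ih =>
    rw [List.pairwise_cons] at hB
    have hzb := hB.1 b (by simp)
    refine Relation.ReflTransGen.head (by simpa using KnuthStep.first [] B hxz hzb) ?_
    simpa using (ih (hxz.trans_le hzb) hB.2).append_left [z]

/-- Row insertion of the letter `x` into the row `A z B` replaces `z` by `x` and bumps `z`. -/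
theorem knuthReach_insert {x z : ℕ} (hxz : x < z) {A B : List ℕ} (hA : A.Pairwise (· ≤ ·))
    (hAx : ∀ a ∈ A, a ≤ x) (hB : (z :: B).Pairwise (· ≤ ·)) :
    KnuthReach (z :: (A ++ x :: B)) ((A ++ z :: B) ++ [x]) := by
  refine (knuthReach_shift_bumped hxz hA hAx B).trans ?_
  simpa using (knuthReach_shift_inserted hxz hB).append_left A

/-! ### Insertion of a weakly increasing word, by letter counts -/

/-- The weakly increasing word with `c j` letters `j` for `j < n`. -/
def rowWord (c : ℕ → ℕ) : ℕ → List ℕ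
  | 0 => []
  | n + 1 => rowWord c n ++ List.replicate (c n) n

theorem lt_of_mem_rowWord {c : ℕ → ℕ} {n x : ℕ} (h : x ∈ rowWord c n) : x < n := by
  induction n with
  | zero => simp [rowWord] at h
  | succ n ih =>
    simp only [rowWord, List.mem_append, List.mem_replicate] at h
    rcases h with h | h
    · exact (ih h).trans n.lt_succ_self
    · omega

theorem pairwise_rowWord (c : ℕ → ℕ) (n : ℕ) : (rowWord c n).Pairwise (· ≤ ·) := by
  induction n with
  | zero => simp [rowWord]
  | succ n ih =>
    simp only [rowWord, List.pairwise_append, List.pairwise_replicate, List.mem_replicate]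
    refine ⟨ih, by simp, fun a ha b hb => ?_⟩
    have := lt_of_mem_rowWord ha
    omega

theorem count_rowWord (c : ℕ → ℕ) (n x : ℕ) :
    (rowWord c n).count x = if x < n then c x else 0 := by
  induction n with
  | zero => simp [rowWord]
  | succ n ih =>
    simp only [rowWord, List.count_append, ih, List.count_replicate, beq_iff_eq]
    rcases lt_trichotomy x n with h | rfl | h
    · simp [h, h.ne', h.trans n.lt_succ_self]
    · simp
    · simp [h.not_gt, h.ne, show ¬ x < n + 1 by omega]

theorem length_rowWord (c : ℕ → ℕ) (n : ℕ) :
    (rowWord c n).length = ∑ j ∈ Finset.range n, c j := by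
  induction n with
  | zero => simp [rowWord]
  | succ n ih => simp [rowWord, ih, Finset.sum_range_succ]

theorem eq_of_pairwise_of_count {l₁ l₂ : List ℕ} (h₁ : l₁.Pairwise (· ≤ ·))
    (h₂ : l₂.Pairwise (· ≤ ·)) (h : ∀ x, l₁.count x = l₂.count x) : l₁ = l₂ :=
  (List.perm_iff_count.2 h).eq_of_pairwise (fun _ _ _ _ => le_antisymm) h₁ h₂

theorem rowWord_congr {c c' : ℕ → ℕ} {n : ℕ} (h : ∀ j < n, c j = c' j) :
    rowWord c n = rowWord c' n := by
  induction n with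
  | zero => rfl
  | succ n ih =>
    rw [rowWord, rowWord, ih fun j hj => h j (hj.trans n.lt_succ_self), h n n.lt_succ_self]

/-- For a row with `r j` letters `j` into which a weakly increasing word with `f j` letters `j`
is inserted: the number of inserted letters below `j` that bump no letter below `j`. -/
def rowQueue (r f : ℕ → ℕ) : ℕ → ℕ
  | 0 => 0
  | j + 1 => (rowQueue r f j - r j) + f j

/-- The number of letters `j` that are bumped. -/
def rowBumped (r f : ℕ → ℕ) (j : ℕ) : ℕ := min (r j) (rowQueue r f j)

/-- The number of letters `j` in the row after the insertion. -/
def rowInserted (r f : ℕ → ℕ) (j : ℕ) : ℕ := (r j - rowQueue r f j) + f j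

section AddLetter

variable {r f g : ℕ → ℕ} {x : ℕ}

theorem rowQueue_add_le (hg : ∀ j, g j = f j + if j = x then 1 else 0) {j : ℕ} (hj : j ≤ x) :
    rowQueue r g j = rowQueue r f j := by
  induction j with
  | zero => rfl
  | succ j ih => simp [rowQueue, ih (by omega), hg, show j ≠ x by omega]

theorem rowQueue_add_succ (hg : ∀ j, g j = f j + if j = x then 1 else 0) :
    rowQueue r g (x + 1) = rowQueue r f (x + 1) + 1 := by
  simp [rowQueue, rowQueue_add_le hg le_rfl, hg, add_assoc]

/-- All letters strictly between `x` and `j` are already bumped by earlier insertions, so the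
additional `x` stays in the queue. -/
theorem rowQueue_add_of_le (hg : ∀ j, g j = f j + if j = x then 1 else 0) {j : ℕ} (hj : x < j)
    (hr : ∀ i, x < i → i < j → r i ≤ rowQueue r f i) :
    rowQueue r g j = rowQueue r f j + 1 := by
  induction j, hj using Nat.le_induction with
  | base => exact rowQueue_add_succ hg
  | succ j hj ih =>
    have h1 := ih fun i hi hij => hr i hi (hij.trans j.lt_succ_self)
    have h2 := hr j hj j.lt_succ_self
    simp only [rowQueue, h1, hg, show j ≠ x by omega, if_false]
    omega

/-- At `z` there are enough letters to absorb the whole queue, the additional `x` included, and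
nothing above `x` is inserted to refill it. -/
theorem rowQueue_add_of_lt (hg : ∀ j, g j = f j + if j = x then 1 else 0)
    (hf : ∀ j, x < j → f j = 0) {z : ℕ} (hxz : x < z)
    (hr : ∀ i, x < i → i < z → r i ≤ rowQueue r f i) (hz : rowQueue r f z < r z) {j : ℕ}
    (hj : z < j) : rowQueue r f j = 0 ∧ rowQueue r g j = 0 := by
  induction j, hj using Nat.le_induction with
  | base =>
    have h1 := rowQueue_add_of_le hg hxz hr
    simp only [rowQueue, hg, hf z hxz, show z ≠ x by omega, if_false, h1]
    omega
  | succ j hj ih =>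
    have h1 := hf j (by omega)
    simp only [rowQueue, hg, h1, ih, show j ≠ x by omega, if_false]
    omega

end AddLetter

theorem rowQueue_zero (r : ℕ → ℕ) (j : ℕ) : rowQueue r (fun _ => 0) j = 0 := by
  induction j with
  | zero => rfl
  | succ j ih => simp [rowQueue, ih]

theorem rowWord_zero (n : ℕ) : rowWord (fun _ => 0) n = [] := by
  induction n with
  | zero => rfl
  | succ n ih => simp [rowWord, ih]

/-- Insertion of the weakly increasing word `w` into the row with `r j` letters `j`. -/
theorem knuthReach_insert_word (r : ℕ → ℕ) (n : ℕ) (w : List ℕ) (hw : w.Pairwise (· ≤ ·))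
    (hn : ∀ x ∈ w, x < n) :
    KnuthReach (rowWord (rowBumped r fun j => w.count j) n ++
      rowWord (rowInserted r fun j => w.count j) n) (rowWord r n ++ w) := by
  induction w using List.reverseRecOn with
  | nil =>
    have h1 : rowBumped r (fun j => ([] : List ℕ).count j) = fun _ => 0 := by
      funext j; simp [rowBumped, rowQueue_zero]
    have h2 : rowInserted r (fun j => ([] : List ℕ).count j) = r := by
      funext j; simp [rowInserted, rowQueue_zero]
    rw [h1, h2, rowWord_zero]
    simpa using Relation.ReflTransGen.refl
  | append_singleton w x ih =>
    rw [List.pairwise_append] at hw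
    have hwx : ∀ y ∈ w, y ≤ x := fun y hy => hw.2.2 y hy x (by simp)
    have hxn : x < n := hn x (by simp)
    have ih := (ih hw.1 fun y hy => hn y (by simp [hy])).append_right [x]
    set f : ℕ → ℕ := fun j => w.count j with hf'
    set g : ℕ → ℕ := fun j => (w ++ [x]).count j with hg'
    have hf : ∀ j, x < j → f j = 0 := fun j hj =>
      List.count_eq_zero.2 fun h => absurd (hwx j h) (by omega)
    have hg : ∀ j, g j = f j + if j = x then 1 else 0 := by
      intro j
      simp only [hf', hg', List.count_append, List.count_singleton, beq_iff_eq, @eq_comm ℕ x j]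
    rw [← List.append_assoc]
    refine Relation.ReflTransGen.trans ?_ ih
    -- The last letter `x` bumps the least `z > x` of which a copy is left after the earlier
    -- insertions; if there is none, `x` is appended to the row.
    by_cases hex : ∃ z, x < z ∧ z < n ∧ rowQueue r f z < r z
    · classical
      obtain ⟨hxz, hzn, hz⟩ := Nat.find_spec hex
      have hmin := fun m => Nat.find_min hex (m := m)
      generalize Nat.find hex = z at *
      have hr : ∀ i, x < i → i < z → r i ≤ rowQueue r f i := by
        intro i hi hiz
        by_contra hlt
        exact hmin i hiz ⟨hi, by omega, by omega⟩
      have hq1 : ∀ j, j ≤ x → rowQueue r g j = rowQueue r f j := fun j => rowQueue_add_le hg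
      have hq2 : ∀ j, x < j → j ≤ z → rowQueue r g j = rowQueue r f j + 1 := fun j hj hjz =>
        rowQueue_add_of_le hg hj fun i hi hij => hr i hi (by omega)
      have hq3 : ∀ j, z < j → rowQueue r f j = 0 ∧ rowQueue r g j = 0 := fun j =>
        rowQueue_add_of_lt hg hf hxz hr hz
      -- No letter strictly between `x` and `z` remains, so the row before the insertion of `x` is
      -- `A ++ z :: B`.
      set A := rowWord (rowInserted r f) (x + 1) with hA
      set B := rowWord (fun j => if j < z then 0 else
        if j = z then rowInserted r f z - 1 else rowInserted r f j) n with hB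
      have hAx : ∀ a ∈ A, a ≤ x := fun a ha => Nat.lt_succ_iff.1 (lt_of_mem_rowWord ha)
      have hAs : A.Pairwise (· ≤ ·) := pairwise_rowWord _ _
      have hzB : ∀ b ∈ B, z ≤ b := by
        intro b hb
        by_contra hlt
        have := List.count_pos_iff.2 hb
        rw [hB, count_rowWord] at this
        simp [show b < z by omega] at this
      have hBs : (z :: B).Pairwise (· ≤ ·) :=
        List.pairwise_cons.2 ⟨hzB, pairwise_rowWord _ _⟩
      have e1 : rowWord (rowBumped r g) n = rowWord (rowBumped r f) n ++ [z] := by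
        refine eq_of_pairwise_of_count (pairwise_rowWord _ _) ?_ fun j => ?_
        · refine List.pairwise_append.2 ⟨pairwise_rowWord _ _, by simp, fun a ha b hb => ?_⟩
          rw [List.mem_singleton.1 hb]
          by_contra hlt
          have := List.count_pos_iff.2 ha
          rw [count_rowWord, rowBumped, (hq3 a (by omega)).1] at this
          simp at this
        · simp only [count_rowWord, List.count_append, List.count_singleton, rowBumped, beq_iff_eq]
          have h1 := hq1 j
          have h2 := hq2 j
          have h3 := hq3 j
          have h4 := hr j
          by_cases hjz : z = j
          · subst hjz
            simp only [hzn, if_true]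
            omega
          · simp only [hjz, if_false]
            split_ifs <;> omega
      have e2 : rowWord (rowInserted r f) n = A ++ z :: B := by
        refine eq_of_pairwise_of_count (pairwise_rowWord _ _) ?_ fun j => ?_
        · refine List.pairwise_append.2 ⟨hAs, hBs, fun a ha b hb => ?_⟩
          have := hAx a ha
          rcases List.mem_cons.1 hb with rfl | hb
          · omega
          · have := hzB b hb
            omega
        · simp only [hA, hB, count_rowWord, List.count_append, List.count_cons, rowInserted,
            beq_iff_eq]
          have h3 := hq3 j
          have h4 := hr j
          have h5 := hf j
          by_cases hjz : z = j
          · subst hjz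
            simp only [hzn, if_true]
            split_ifs <;> omega
          · simp only [Ne.symm hjz, if_false]
            split_ifs <;> omega
      have e3 : rowWord (rowInserted r g) n = A ++ x :: B := by
        refine eq_of_pairwise_of_count (pairwise_rowWord _ _) ?_ fun j => ?_
        · refine List.pairwise_append.2 ⟨hAs, List.pairwise_cons.2 ⟨fun b hb => ?_,
            (List.pairwise_cons.1 hBs).2⟩, fun a ha b hb => ?_⟩
          · have := hzB b hb
            omega
          · have := hAx a ha
            rcases List.mem_cons.1 hb with rfl | hb
            · exact this
            · have := hzB b hb
              omega
        · simp only [hA, hB, count_rowWord, List.count_append, List.count_cons, rowInserted,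
            beq_iff_eq]
          have h1 := hq1 j
          have h2 := hq2 j
          have h3 := hq3 j
          have h4 := hr j
          have h5 := hf j
          have h6 := hg j
          by_cases hjz : z = j
          · subst hjz
            simp only [hzn, if_true, hxz.ne, if_false] at h6 ⊢
            split_ifs at h6 ⊢ <;> omega
          · simp only [Ne.symm hjz, if_false]
            split_ifs at h6 ⊢ <;> omega
      rw [e1, e2, e3]
      simpa using (knuthReach_insert hxz hAs hAx hBs).append_left (rowWord (rowBumped r f) n)
    · have hr : ∀ i, x < i → i < n → r i ≤ rowQueue r f i := by
        intro i hi hin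
        by_contra hlt
        exact hex ⟨i, hi, hin, by omega⟩
      have hq1 : ∀ j, j ≤ x → rowQueue r g j = rowQueue r f j := fun j => rowQueue_add_le hg
      have hq2 : ∀ j, x < j → j < n → rowQueue r g j = rowQueue r f j + 1 := fun j hj hjn =>
        rowQueue_add_of_le hg hj fun i hi hij => hr i hi (by omega)
      have e1 : rowWord (rowBumped r g) n = rowWord (rowBumped r f) n := by
        refine rowWord_congr fun j hj => ?_
        have h1 := hq1 j
        have h2 := hq2 j
        have h4 := hr j
        simp only [rowBumped]
        omega
      have e2 : rowWord (rowInserted r g) n = rowWord (rowInserted r f) n ++ [x] := by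
        refine eq_of_pairwise_of_count (pairwise_rowWord _ _) ?_ fun j => ?_
        · refine List.pairwise_append.2 ⟨pairwise_rowWord _ _, by simp, fun a ha b hb => ?_⟩
          rw [List.mem_singleton.1 hb]
          by_contra hlt
          have h0 := lt_of_mem_rowWord ha
          have := List.count_pos_iff.2 ha
          have h4 := hr a
          have h5 := hf a
          rw [count_rowWord, if_pos h0, rowInserted] at this
          omega
        · simp only [count_rowWord, List.count_append, List.count_singleton, rowInserted,
            beq_iff_eq]
          have h1 := hq1 j
          have h2 := hq2 j
          have h4 := hr j
          have h5 := hf j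
          have h6 := hg j
          split_ifs at h6 ⊢ <;> omega
      rw [e1, e2, List.append_assoc]

/-- Insertion of the word with `f j` letters `j` into the row with `r j` letters `j`. -/
theorem knuthReach_insert_row (r f : ℕ → ℕ) (n : ℕ) :
    KnuthReach (rowWord (rowBumped r f) n ++ rowWord (rowInserted r f) n)
      (rowWord r n ++ rowWord f n) := by
  have h := knuthReach_insert_word r n (rowWord f n) (pairwise_rowWord _ _)
    fun x => lt_of_mem_rowWord
  have hf : ∀ j < n, (rowWord f n).count j = f j := fun j hj => by simp [count_rowWord, hj]
  have hq : ∀ j ≤ n, rowQueue r (fun j => (rowWord f n).count j) j = rowQueue r f j := by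
    intro j hj
    induction j with
    | zero => rfl
    | succ j ih => simp only [rowQueue, ih (by omega), hf j (by omega)]
  have e1 : rowWord (rowBumped r fun j => (rowWord f n).count j) n =
      rowWord (rowBumped r f) n :=
    rowWord_congr fun j hj => by simp only [rowBumped, hq j hj.le]
  have e2 : rowWord (rowInserted r fun j => (rowWord f n).count j) n =
      rowWord (rowInserted r f) n :=
    rowWord_congr fun j hj => by simp only [rowInserted, hq j hj.le, hf j hj]
  rwa [e1, e2] at h

/-! ### Reading words of tableaux and fillings, and their chains -/

/-- The row reading word of a tableau with rows `0, …, h - 1`, whose row `i` has `c i j`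
letters `j`. -/
def tableauWord (c : ℕ → ℕ → ℕ) (b : ℕ) : ℕ → List ℕ
  | 0 => []
  | h + 1 => rowWord (c h) b ++ tableauWord c b h

/-- The cells of the first `a` rows of the filling `f`, cut off at column `b` and read row by row,
each repeated as often as its entry says. -/
def fillingCells (f : ℕ × ℕ → ℕ) (b : ℕ) : ℕ → List (ℕ × ℕ)
  | 0 => []
  | a + 1 => fillingCells f b a ++ (rowWord (fun j => f (a, j)) b).map (Prod.mk a)

theorem length_tableauWord (c : ℕ → ℕ → ℕ) (b h : ℕ) :
    (tableauWord c b h).length = ∑ i ∈ Finset.range h, ∑ j ∈ Finset.range b, c i j := by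
  induction h with
  | zero => rfl
  | succ h ih =>
    simp [tableauWord, ih, Finset.sum_range_succ, length_rowWord, add_comm]

theorem length_fillingCells (f : ℕ × ℕ → ℕ) (a b : ℕ) :
    (fillingCells f b a).length = ∑ p ∈ cornerRect a b, f p := by
  rw [cornerRect, Finset.sum_product]
  induction a with
  | zero => rfl
  | succ a ih => simp [fillingCells, ih, Finset.sum_range_succ, length_rowWord]

/-- Colour every letter by its row. The induction also records that the colours used are below `h`,
so that the next row gets a fresh one. -/
theorem hasChains_le_tableauWord (c : ℕ → ℕ → ℕ) (b h k : ℕ) :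
    HasChains (· ≤ ·) k (tableauWord c b h)
      (∑ i ∈ Finset.range h, if i < k then ∑ j ∈ Finset.range b, c i j else 0) := by
  suffices H : ∃ L : List (ℕ × ℕ), IsColoring (· ≤ ·) k L ∧
      L.map Prod.fst = tableauWord c b h ∧
      (∑ i ∈ Finset.range h, if i < k then ∑ j ∈ Finset.range b, c i j else 0) ≤
        L.countP (fun p => p.2 < k) ∧ ∀ p ∈ L, p.2 < h by
    obtain ⟨L, h1, h2, h3, -⟩ := H
    exact ⟨L, h1, h2, h3⟩
  induction h with
  | zero => exact ⟨[], List.Pairwise.nil, rfl, by simp, by simp⟩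
  | succ h ih =>
    obtain ⟨L, h1, h2, h3, h4⟩ := ih
    refine ⟨(rowWord (c h) b).map (fun x => (x, h)) ++ L, ?_, ?_, ?_, ?_⟩
    · refine List.pairwise_append.2 ⟨?_, h1, ?_⟩
      · exact List.pairwise_map.2 ((pairwise_rowWord _ _).imp fun hxy _ _ => hxy)
      · intro p hp q hq hpq
        obtain ⟨x, -, rfl⟩ := List.mem_map.1 hp
        have := h4 q hq
        simp only at hpq
        omega
    · simp [tableauWord, h2, Function.comp_def]
    · rw [Finset.sum_range_succ, List.countP_append, List.countP_map, add_comm]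
      refine Nat.add_le_add ?_ h3
      split_ifs with hk
      · simp [Function.comp_def, hk, length_rowWord]
      · exact Nat.zero_le _
    · intro p hp
      rcases List.mem_append.1 hp with hp | hp
      · obtain ⟨x, -, rfl⟩ := List.mem_map.1 hp
        exact h.lt_succ_self
      · exact (h4 p hp).trans h.lt_succ_self

theorem of_mem_zipIdx_rowWord {c : ℕ → ℕ} {n x p : ℕ} (h : (x, p) ∈ (rowWord c n).zipIdx) :
    x < n ∧ ∑ j ∈ Finset.range x, c j ≤ p ∧ p < ∑ j ∈ Finset.range (x + 1), c j := by
  induction n with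
  | zero => simp [rowWord] at h
  | succ n ih =>
    rw [rowWord, List.zipIdx_append, List.mem_append] at h
    rcases h with h | h
    · have := ih h
      exact ⟨by omega, this.2⟩
    · obtain ⟨h1, h2, h3⟩ := List.mem_zipIdx h
      simp only [List.getElem_replicate, List.length_replicate, length_rowWord] at h1 h2 h3
      subst h3
      rw [Finset.sum_range_succ]
      omega

theorem countP_zipIdx (l : List ℕ) (k m : ℕ) :
    (l.zipIdx m).countP (fun p => p.2 < k) = min (k - m) l.length := by
  induction l generalizing m with
  | nil => simp
  | cons x l ih =>
    rw [List.zipIdx_cons, List.countP_cons, ih]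
    simp only [List.length_cons, decide_eq_true_eq]
    split_ifs <;> omega

/-- Colour every letter by its column, that is, its position in its row. Higher rows are read first,
so `hc`, strict increase up the columns, makes each colour class decrease; a row of length `s` has
`min k s` letters in the first `k` columns. -/
theorem hasChains_gt_tableauWord (c : ℕ → ℕ → ℕ) (b h k : ℕ)
    (hc : ∀ i i' x y p, i < i' → (x, p) ∈ (rowWord (c i') b).zipIdx →
      (y, p) ∈ (rowWord (c i) b).zipIdx → y < x) :
    HasChains (· > ·) k (tableauWord c b h)
      (∑ i ∈ Finset.range h, min k (∑ j ∈ Finset.range b, c i j)) := by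
  suffices H : ∃ L : List (ℕ × ℕ), IsColoring (· > ·) k L ∧
      L.map Prod.fst = tableauWord c b h ∧
      (∑ i ∈ Finset.range h, min k (∑ j ∈ Finset.range b, c i j)) ≤
        L.countP (fun p => p.2 < k) ∧ ∀ p ∈ L, ∃ i < h, p ∈ (rowWord (c i) b).zipIdx by
    obtain ⟨L, h1, h2, h3, -⟩ := H
    exact ⟨L, h1, h2, h3⟩
  induction h with
  | zero => exact ⟨[], List.Pairwise.nil, rfl, by simp, by simp⟩
  | succ h ih =>
    obtain ⟨L, h1, h2, h3, h4⟩ := ih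
    refine ⟨(rowWord (c h) b).zipIdx ++ L, ?_, ?_, ?_, ?_⟩
    · refine List.pairwise_append.2 ⟨?_, h1, ?_⟩
      · have hnd : ((rowWord (c h) b).zipIdx.map Prod.snd).Nodup := by
          rw [List.zipIdx_map_snd]
          exact List.nodup_range'
        exact (List.pairwise_map.1 hnd).imp fun hpq h => absurd h hpq
      · rintro ⟨x, p⟩ hp ⟨y, q⟩ hq hpq -
        obtain ⟨i, hi, hq⟩ := h4 _ hq
        simp only at hpq
        subst hpq
        exact hc _ _ _ _ _ hi hp hq
    · simp [tableauWord, h2]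
    · rw [Finset.sum_range_succ, List.countP_append, countP_zipIdx, add_comm, length_rowWord]
      exact Nat.add_le_add le_rfl h3
    · intro p hp
      rcases List.mem_append.1 hp with hp | hp
      · exact ⟨h, h.lt_succ_self, hp⟩
      · obtain ⟨i, hi, hp⟩ := h4 p hp
        exact ⟨i, hi.trans h.lt_succ_self, hp⟩

/-! ### The labels as tableaux, and the forward rule as row insertion -/

theorem YoungDiagram.rowLen_bot (i : ℕ) : (⊥ : YoungDiagram).rowLen i = 0 := by
  by_contra h
  have : (i, 0) ∈ (⊥ : YoungDiagram) := YoungDiagram.mem_iff_lt_rowLen.2 (Nat.pos_of_ne_zero h)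
  simp at this

section Growth

variable {F : YoungDiagram} {f : ℕ × ℕ → ℕ} {Λ : ℕ → ℕ → YoungDiagram} {a b : ℕ}

theorem IsRSKDiagram.rule (hΛ : IsRSKDiagram F f Λ) (hc : IsShapeCorner F a b) {i j : ℕ}
    (hi : i < a) (hj : j < b) :
    RSKRule (f (i, j)) (Λ i j) (Λ i (j + 1)) (Λ (i + 1) j) (Λ (i + 1) (j + 1)) :=
  hΛ.cell i j (hc _ (by simp [cornerRect, hi, hj]))

theorem IsRSKDiagram.rowLen_left (hΛ : IsRSKDiagram F f Λ) (i k : ℕ) :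
    (Λ i 0).rowLen k = 0 := by
  rw [hΛ.left, YoungDiagram.rowLen_bot]

theorem IsRSKDiagram.rowLen_bottom (hΛ : IsRSKDiagram F f Λ) (j k : ℕ) :
    (Λ 0 j).rowLen k = 0 := by
  rw [hΛ.bottom, YoungDiagram.rowLen_bot]

theorem IsRSKDiagram.rowLen_le_right (hΛ : IsRSKDiagram F f Λ) (hc : IsShapeCorner F a b)
    {i j : ℕ} (hi : i ≤ a) (hj : j < b) (k : ℕ) :
    (Λ i j).rowLen k ≤ (Λ i (j + 1)).rowLen k := by
  cases i with
  | zero => simp [hΛ.rowLen_bottom]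
  | succ i =>
    rw [hΛ.rule hc hi hj k]
    omega

theorem IsRSKDiagram.rowLen_le_up (hΛ : IsRSKDiagram F f Λ) (hc : IsShapeCorner F a b)
    {i j : ℕ} (hi : i < a) (hj : j ≤ b) (k : ℕ) :
    (Λ i j).rowLen k ≤ (Λ (i + 1) j).rowLen k := by
  cases j with
  | zero => simp [hΛ.rowLen_left]
  | succ j =>
    rw [hΛ.rule hc hi hj k]
    omega

theorem IsRSKDiagram.rowLen_mono_right (hΛ : IsRSKDiagram F f Λ) (hc : IsShapeCorner F a b)
    {i j j' : ℕ} (hi : i ≤ a) (hjj : j ≤ j') (hj : j' ≤ b) (k : ℕ) :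
    (Λ i j).rowLen k ≤ (Λ i j').rowLen k := by
  induction j', hjj using Nat.le_induction with
  | base => exact le_rfl
  | succ j' _ ih => exact (ih (by omega)).trans (hΛ.rowLen_le_right hc hi hj k)

theorem IsRSKDiagram.rowLen_mono_up (hΛ : IsRSKDiagram F f Λ) (hc : IsShapeCorner F a b)
    {i i' j : ℕ} (hj : j ≤ b) (hii : i ≤ i') (hi : i' ≤ a) (k : ℕ) :
    (Λ i j).rowLen k ≤ (Λ i' j).rowLen k := by
  induction i', hii using Nat.le_induction with
  | base => exact le_rfl
  | succ i' _ ih => exact (ih (by omega)).trans (hΛ.rowLen_le_up hc hi hj k)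

/-- Partitions at corners that are neighbours in a row differ by a horizontal strip. -/
theorem IsRSKDiagram.rowLen_succ_le (hΛ : IsRSKDiagram F f Λ) (hc : IsShapeCorner F a b)
    {i j : ℕ} (hi : i ≤ a) (hj : j < b) (k : ℕ) :
    (Λ i (j + 1)).rowLen (k + 1) ≤ (Λ i j).rowLen k := by
  -- Both strip conditions pass through a cell: if `μ_{k+1}, ν_{k+1} ≤ ρ_k`, the rule gives `λ_{k+1}
  -- ≤ min (μ_k, ν_k)`.
  have hcell : ∀ i < a, ∀ j < b, (Λ i (j + 1)).rowLen (k + 1) ≤ (Λ i j).rowLen k →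
      (Λ (i + 1) j).rowLen (k + 1) ≤ (Λ i j).rowLen k →
      (Λ (i + 1) (j + 1)).rowLen (k + 1) ≤ (Λ i (j + 1)).rowLen k ∧
      (Λ (i + 1) (j + 1)).rowLen (k + 1) ≤ (Λ (i + 1) j).rowLen k := by
    intro i hi j hj h1 h2
    have h3 := hΛ.rule hc hi hj (k + 1)
    have h4 := hΛ.rowLen_le_right hc hi.le hj k
    have h5 := hΛ.rowLen_le_up hc hi hj.le k
    rw [rskCarry] at h3
    omega
  induction i generalizing j with
  | zero => simp [hΛ.rowLen_bottom]
  | succ i ih =>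
    have hv : ∀ j ≤ b, (Λ (i + 1) j).rowLen (k + 1) ≤ (Λ i j).rowLen k := by
      intro j hj
      induction j with
      | zero => simp [hΛ.rowLen_left]
      | succ j ihj => exact (hcell i hi j hj (ih (by omega) hj) (ihj (by omega))).1
    exact (hcell i hi j hj (ih (by omega) hj) (hv j hj.le)).2

/-- The number of letters `j` in row `i` of the semistandard tableau that is given by the labels
at height `a`. -/
def tableauContent (Λ : ℕ → ℕ → YoungDiagram) (a i j : ℕ) : ℕ :=
  (Λ a (j + 1)).rowLen i - (Λ a j).rowLen i

theorem IsRSKDiagram.sum_tableauContent (hΛ : IsRSKDiagram F f Λ) (hc : IsShapeCorner F a b)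
    {i j : ℕ} (hi : i ≤ a) (hj : j ≤ b) (k : ℕ) :
    ∑ t ∈ Finset.range j, tableauContent Λ i k t = (Λ i j).rowLen k := by
  induction j with
  | zero => simp [hΛ.rowLen_left]
  | succ j ih =>
    rw [Finset.sum_range_succ, ih (by omega), tableauContent]
    exact Nat.add_sub_cancel' (hΛ.rowLen_le_right hc hi hj k)

/-- The tableau at height `i + 1` comes from the one at height `i` by row insertion. -/
theorem IsRSKDiagram.knuthReach_row (hΛ : IsRSKDiagram F f Λ) (hc : IsShapeCorner F a b)
    {i : ℕ} (hi : i < a) (h : ℕ) :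
    KnuthReach
      (rowWord (fun j => rskCarry (f (i, j)) (Λ i j) (Λ i (j + 1)) (Λ (i + 1) j) h) b ++
        tableauWord (tableauContent Λ (i + 1)) b h)
      (tableauWord (tableauContent Λ i) b h ++ rowWord (fun j => f (i, j)) b) := by
  induction h with
  | zero => simpa [tableauWord, rskCarry] using Relation.ReflTransGen.refl
  | succ h ih =>
    set g : ℕ → ℕ := fun j => rskCarry (f (i, j)) (Λ i j) (Λ i (j + 1)) (Λ (i + 1) j) h
    -- The queue is the growth `ν_h - ρ_h` of row `h` between the two heights. As row `h` has `μ_h -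
    -- ρ_h` letters `j`, the number bumped is `min (μ_h, ν_h) - ρ_h`, the next carry.
    have hq : ∀ j ≤ b, rowQueue (tableauContent Λ i h) g j =
        (Λ (i + 1) j).rowLen h - (Λ i j).rowLen h := by
      intro j hj
      induction j with
      | zero => simp [rowQueue, hΛ.rowLen_left]
      | succ j ihj =>
        have h3 : _ = _ + g j := hΛ.rule hc hi hj h
        have h4 := hΛ.rowLen_le_right hc hi.le hj h
        have h5 := hΛ.rowLen_le_up hc hi (Nat.le_of_succ_le hj) h
        rw [rowQueue, ihj (by omega), tableauContent]
        omega
    have e1 : rowWord (fun j => rskCarry (f (i, j)) (Λ i j) (Λ i (j + 1)) (Λ (i + 1) j) (h + 1)) b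
        = rowWord (rowBumped (tableauContent Λ i h) g) b := by
      refine rowWord_congr fun j hj => ?_
      have h4 := hΛ.rowLen_le_right hc hi.le hj h
      have h5 := hΛ.rowLen_le_up hc hi hj.le h
      rw [rskCarry, rowBumped, hq j hj.le, tableauContent]
      omega
    have e2 : rowWord (tableauContent Λ (i + 1) h) b =
        rowWord (rowInserted (tableauContent Λ i h) g) b := by
      refine rowWord_congr fun j hj => ?_
      have h3 : _ = _ + g j := hΛ.rule hc hi hj h
      have h4 := hΛ.rowLen_le_right hc hi.le hj h
      have h5 := hΛ.rowLen_le_up hc hi hj.le h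
      rw [rowInserted, hq j hj.le, tableauContent, tableauContent]
      omega
    rw [tableauWord, tableauWord, e1, e2, ← List.append_assoc, List.append_assoc]
    refine Relation.ReflTransGen.trans ?_ (by simpa using ih.append_left _)
    simpa using (knuthReach_insert_row (tableauContent Λ i h) g b).append_right
      (tableauWord (tableauContent Λ (i + 1)) b h)

/-- The reading word of the filling is Knuth equivalent to that of the tableau. -/
theorem IsRSKDiagram.knuthReach_filling (hΛ : IsRSKDiagram F f Λ) (hc : IsShapeCorner F a b)
    {h : ℕ} (hh : (Λ a b).rowLen h = 0) {i : ℕ} (hi : i ≤ a) :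
    KnuthReach (tableauWord (tableauContent Λ i) b (h + 1))
      ((fillingCells f b i).map Prod.snd) := by
  induction i with
  | zero =>
    have : tableauWord (tableauContent Λ 0) b (h + 1) = [] := by
      rw [← List.length_eq_zero_iff, length_tableauWord]
      simp [tableauContent, hΛ.rowLen_bottom]
    rw [this]
    exact .refl
  | succ i ih =>
    -- No letter is bumped out of row `h`, which is empty at all heights up to `a`. Keeping this
    -- empty row puts the carry at index `h + 1`, where it is a difference of labels even when `h =
    -- 0`.
    have h0 : rowWord (fun j => rskCarry (f (i, j)) (Λ i j) (Λ i (j + 1)) (Λ (i + 1) j) (h + 1)) b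
        = [] := by
      rw [← rowWord_zero b]
      refine rowWord_congr fun j hj => ?_
      have h1 := hΛ.rowLen_mono_right hc (Nat.le_of_succ_le hi) (show j + 1 ≤ b from hj) le_rfl h
      have h2 := hΛ.rowLen_mono_up hc le_rfl (Nat.le_of_succ_le hi) le_rfl h
      rw [rskCarry]
      omega
    have h1 := hΛ.knuthReach_row hc hi (h + 1)
    rw [h0, List.nil_append] at h1
    refine h1.trans ?_
    simpa [fillingCells, Function.comp_def] using
      (ih (by omega)).append_right (rowWord (fun j => f (i, j)) b)

theorem IsRSKDiagram.hasChains_le (hΛ : IsRSKDiagram F f Λ) (hc : IsShapeCorner F a b)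
    {h : ℕ} (hh : (Λ a b).rowLen h = 0) (k : ℕ) :
    HasChains (· ≤ ·) k ((fillingCells f b a).map Prod.snd)
      (∑ i ∈ Finset.range (h + 1), if i < k then (Λ a b).rowLen i else 0) := by
  have := (hasChains_le_tableauWord (tableauContent Λ a) b (h + 1) k).le_of_reach
    (hΛ.knuthReach_filling hc hh le_rfl)
  simpa only [hΛ.sum_tableauContent hc le_rfl le_rfl] using this

theorem IsRSKDiagram.hasChains_gt (hΛ : IsRSKDiagram F f Λ) (hc : IsShapeCorner F a b)
    {h : ℕ} (hh : (Λ a b).rowLen h = 0) (k : ℕ) :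
    HasChains (· > ·) k ((fillingCells f b a).map Prod.snd)
      (∑ i ∈ Finset.range (h + 1), min k ((Λ a b).rowLen i)) := by
  have := (hasChains_gt_tableauWord (tableauContent Λ a) b (h + 1) k ?_).gt_of_reach
    (hΛ.knuthReach_filling hc hh le_rfl)
  · simpa only [hΛ.sum_tableauContent hc le_rfl le_rfl] using this
  · intro i i' x y p hii hx hy
    obtain ⟨hxb, hx1, hx2⟩ := of_mem_zipIdx_rowWord hx
    obtain ⟨hyb, hy1, hy2⟩ := of_mem_zipIdx_rowWord hy
    rw [hΛ.sum_tableauContent hc le_rfl (by omega)] at hx1 hx2 hy1 hy2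
    -- If `x ≤ y`, then `p < Λ a (x + 1)` in row `i'`, which is at most `Λ a (x + 1)` in row `i +
    -- 1`, hence by the strip condition at most `Λ a x` and so `Λ a y` in row `i`, which is at most
    -- `p`.
    by_contra hlt
    have h1 := hΛ.rowLen_succ_le hc le_rfl hxb i
    have h2 := (Λ a (x + 1)).rowLen_anti _ _ (show i + 1 ≤ i' from hii)
    have h3 := hΛ.rowLen_mono_right hc le_rfl (show x ≤ y by omega) hyb.le i
    omega

theorem IsRSKDiagram.sum_rowLen (hΛ : IsRSKDiagram F f Λ) (hc : IsShapeCorner F a b)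
    {h : ℕ} (hh : (Λ a b).rowLen h = 0) :
    ∑ i ∈ Finset.range (h + 1), (Λ a b).rowLen i = ∑ p ∈ cornerRect a b, f p := by
  have := (hΛ.knuthReach_filling hc hh le_rfl).length_eq
  rw [List.length_map, length_fillingCells, length_tableauWord] at this
  simpa only [hΛ.sum_tableauContent hc le_rfl le_rfl] using this

end Growth

/-! ### From chains of letters to chains of cells -/

theorem count_fillingCells (f : ℕ × ℕ → ℕ) (a b : ℕ) (p : ℕ × ℕ) :
    (fillingCells f b a).count p = if p ∈ cornerRect a b then f p else 0 := by
  obtain ⟨i, j⟩ := p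
  simp only [cornerRect, Finset.mem_product, Finset.mem_range]
  induction a with
  | zero => simp [fillingCells]
  | succ a ih =>
    rw [fillingCells, List.count_append, ih]
    by_cases hi : i = a
    · subst hi
      rw [List.count_map_of_injective _ _ (Prod.mk_right_injective i), count_rowWord]
      simp
    · have h0 : ((rowWord (fun j => f (a, j)) b).map (Prod.mk a)).count (i, j) = 0 := by
        rw [List.count_eq_zero]
        intro h
        obtain ⟨x, -, hx⟩ := List.mem_map.1 h
        exact hi (Prod.ext_iff.1 hx).1.symm
      rw [h0, add_zero]
      have : i < a + 1 ↔ i < a := by omega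
      simp [this]

theorem mem_of_mem_fillingCells {f : ℕ × ℕ → ℕ} {a b : ℕ} {p : ℕ × ℕ}
    (h : p ∈ fillingCells f b a) : p ∈ cornerRect a b ∧ f p ≠ 0 := by
  have := List.count_pos_iff.2 h
  rw [count_fillingCells] at this
  split_ifs at this with hp
  · exact ⟨hp, by omega⟩
  · omega

theorem pairwise_fillingCells (f : ℕ × ℕ → ℕ) (a b : ℕ) :
    (fillingCells f b a).Pairwise fun p q => p.1 < q.1 ∨ p.1 = q.1 ∧ p.2 ≤ q.2 := by
  induction a with
  | zero => exact List.Pairwise.nil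
  | succ a ih =>
    refine List.pairwise_append.2 ⟨ih, ?_, ?_⟩
    · exact List.pairwise_map.2 ((pairwise_rowWord _ _).imp fun h => Or.inr ⟨rfl, h⟩)
    · intro p hp q hq
      obtain ⟨x, -, rfl⟩ := List.mem_map.1 hq
      have := (mem_of_mem_fillingCells hp).1
      simp only [cornerRect, Finset.mem_product, Finset.mem_range] at this
      exact Or.inl this.1

theorem exists_map_fst_eq {α β γ : Type*} (g : α → β) (l : List α) (L : List (β × γ))
    (h : L.map Prod.fst = l.map g) :
    ∃ M : List (α × γ), M.map Prod.fst = l ∧ M.map (Prod.map g id) = L := by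
  induction l generalizing L with
  | nil =>
    obtain rfl : L = [] := by simpa using h
    exact ⟨[], rfl, rfl⟩
  | cons x l ih =>
    obtain ⟨⟨y, c⟩, L, rfl, h1, h2⟩ := List.map_eq_cons_iff.1 h
    obtain ⟨M, rfl, rfl⟩ := ih L h2
    exact ⟨(x, c) :: M, rfl, by simpa using h1.symm⟩

/-- The cells of colour `t` in a list of coloured cells. -/
def cellsOfColor (M : List ((ℕ × ℕ) × ℕ)) (t : ℕ) : List (ℕ × ℕ) :=
  (M.filter fun m => m.2 = t).map Prod.fst

theorem mem_cellsOfColor {M : List ((ℕ × ℕ) × ℕ)} {t : ℕ} {p : ℕ × ℕ} :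
    p ∈ cellsOfColor M t ↔ (p, t) ∈ M := by
  simp [cellsOfColor]

theorem sum_length_cellsOfColor (M : List ((ℕ × ℕ) × ℕ)) (k : ℕ) :
    ∑ t : Fin k, (cellsOfColor M t).length = M.countP (fun m => m.2 < k) := by
  rw [Fin.sum_univ_eq_sum_range (fun t => (cellsOfColor M t).length)]
  induction M with
  | nil => simp [cellsOfColor]
  | cons m M ih =>
    have : ∀ t, (cellsOfColor (m :: M) t).length =
        (cellsOfColor M t).length + if m.2 = t then 1 else 0 := by
      intro t
      by_cases h : m.2 = t <;> simp [cellsOfColor, h]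
    simp only [this, Finset.sum_add_distrib, ih, List.countP_cons, Finset.sum_ite_eq,
      Finset.mem_range, decide_eq_true_eq]

/-- Disjoint chains in the reading word of a filling, as chains of (repeated) cells. -/
theorem HasChains.exists_cells {r : ℕ → ℕ → Prop} {k N : ℕ} {f : ℕ × ℕ → ℕ} {a b : ℕ}
    (h : HasChains r k ((fillingCells f b a).map Prod.snd) N) :
    ∃ M : List ((ℕ × ℕ) × ℕ), M.map Prod.fst = fillingCells f b a ∧
      N ≤ M.countP (fun m => m.2 < k) ∧
      ∀ t < k, (cellsOfColor M t).Pairwise fun p q =>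
        (p.1 < q.1 ∨ p.1 = q.1 ∧ p.2 ≤ q.2) ∧ r p.2 q.2 := by
  obtain ⟨L, hL, hLw, hN⟩ := h
  obtain ⟨M, hM, rfl⟩ := exists_map_fst_eq _ _ _ hLw
  refine ⟨M, hM, ?_, fun t ht => ?_⟩
  · rw [List.countP_map] at hN
    exact hN
  · have h1 := pairwise_fillingCells f a b
    rw [← hM, List.pairwise_map] at h1
    refine List.pairwise_map.2 (List.pairwise_filter.2 ?_)
    refine (h1.and (List.pairwise_map.1 hL)).imp ?_
    rintro p q ⟨h2, h3⟩ hp hq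
    simp only [decide_eq_true_eq] at hp hq
    exact ⟨h2, h3 (hp.trans hq.symm) (hp.trans_lt ht)⟩

theorem isChain_toFinset_of_pairwise {α : Type*} [DecidableEq α] {r : α → α → Prop} {l : List α}
    (h : l.Pairwise r) : IsChain r (l.toFinset : Set α) := by
  intro x hx y hy hxy
  have : Std.Symm fun x y => r x y ∨ r y x := ⟨fun _ _ => Or.symm⟩
  have h' : l.Pairwise fun x y => r x y ∨ r y x := h.imp Or.inl
  exact h'.forall (by simpa using hx) (by simpa using hy) hxy

/-- Copies of one cell may carry different colours, so the colour classes are shrunk to disjoint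
sets of cells with the same union. No length is lost: a cell contributes its full entry, which
bounds the number of its coloured copies. -/
theorem HasChains.exists_neTotal {k N : ℕ} {f : ℕ × ℕ → ℕ} {a b : ℕ}
    (h : HasChains (· ≤ ·) k ((fillingCells f b a).map Prod.snd) N) :
    ∃ n ∈ neTotals f a b k, N ≤ n := by
  obtain ⟨M, hM, hN, hchain⟩ := h.exists_cells
  have hmem : ∀ p t, (p, t) ∈ M → p ∈ cornerRect a b ∧ f p ≠ 0 := fun p t hp =>
    mem_of_mem_fillingCells (hM ▸ List.mem_map_of_mem (f := Prod.fst) hp)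
  obtain ⟨C, hC, hsup, hdisj⟩ := Fintype.exists_disjointed_le
    fun t : Fin k => (cellsOfColor M t).toFinset
  have hCM : ∀ t, ∀ p ∈ C t, (p, t.1) ∈ M := fun t p hp =>
    mem_cellsOfColor.1 (List.mem_toFinset.1 (hC t hp))
  refine ⟨_, ⟨C, fun t => ⟨⟨fun p hp => (hmem _ _ (hCM t p hp)).2, ?_⟩,
    fun p hp => (hmem _ _ (hCM t p hp)).1⟩, fun s t hst => hdisj hst, rfl⟩, ?_⟩
  · refine (isChain_toFinset_of_pairwise ((hchain t t.2).imp ?_)).mono (Finset.coe_subset.2 (hC t))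
    intro p q hpq
    exact ⟨by omega, hpq.2⟩
  · rw [← Finset.sum_biUnion fun s _ t _ hst => hdisj hst]
    refine hN.trans ?_
    rw [List.countP_eq_length_filter, ← List.length_map (f := Prod.fst),
      ← List.sum_toFinset_count_eq_length]
    refine (Finset.sum_le_sum fun p _ => ?_).trans (Finset.sum_le_sum_of_subset ?_)
    · have hcount := (List.Sublist.map Prod.fst
        (List.filter_sublist (p := fun m => decide (m.2 < k)) (l := M))).count_le p
      rw [hM, count_fillingCells] at hcount
      convert hcount.trans (show _ ≤ f p by split_ifs <;> omega)
    · intro p hp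
      simp only [List.mem_toFinset, List.mem_map, List.mem_filter, decide_eq_true_eq] at hp
      obtain ⟨⟨p, t⟩, ⟨hm, ht⟩, rfl⟩ := hp
      rw [← Finset.sup_eq_biUnion, hsup, Finset.mem_sup]
      exact ⟨⟨t, ht⟩, Finset.mem_univ _, List.mem_toFinset.2 (mem_cellsOfColor.2 hm)⟩

/-- Strict decrease allows at most one copy of a cell per colour, so passing to sets keeps the
lengths; a cell has only `f p` copies, which bounds the number of its colours. -/
theorem HasChains.exists_seTotal {k N : ℕ} {f : ℕ × ℕ → ℕ} {a b : ℕ}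
    (h : HasChains (· > ·) k ((fillingCells f b a).map Prod.snd) N) :
    ∃ n ∈ seTotals f a b k, N ≤ n := by
  obtain ⟨M, hM, hN, hchain⟩ := h.exists_cells
  have hmem : ∀ p t, (p, t) ∈ M → p ∈ cornerRect a b ∧ f p ≠ 0 := fun p t hp =>
    mem_of_mem_fillingCells (hM ▸ List.mem_map_of_mem (f := Prod.fst) hp)
  have hCM : ∀ t, ∀ p ∈ (cellsOfColor M t).toFinset, (p, t) ∈ M := fun t p hp =>
    mem_cellsOfColor.1 (List.mem_toFinset.1 hp)
  refine ⟨_, ⟨fun t : Fin k => (cellsOfColor M t).toFinset,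
    fun t => ⟨⟨fun p hp => (hmem _ _ (hCM t p hp)).2, ?_⟩,
    fun p hp => (hmem _ _ (hCM t p hp)).1⟩, fun p => ?_, rfl⟩, ?_⟩
  · have := isChain_toFinset_of_pairwise (hchain t t.2)
    intro p hp q hq hpq
    -- Within a row the columns are read in weakly increasing order, so a strict decrease of the
    -- column forces a strictly higher row.
    rcases this hp hq hpq with h | h
    · exact Or.inr ⟨by omega, h.2⟩
    · exact Or.inl ⟨by omega, h.2⟩
  · by_cases hp : p ∈ cornerRect a b
    · have hcount : (M.filter fun m => m.1 = p).length = f p := by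
        rw [← List.countP_eq_length_filter]
        have := count_fillingCells f a b p
        rw [if_pos hp, ← hM, List.count, List.countP_map] at this
        rw [← this]
        congr 1
        funext m
        by_cases h : m.1 = p <;> simp [h]
      rw [← hcount, ← List.length_map (f := Prod.snd), ← Finset.card_map Fin.valEmbedding]
      refine (Finset.card_le_card ?_).trans (List.toFinset_card_le _)
      intro t ht
      obtain ⟨s, hs, rfl⟩ := Finset.mem_map.1 ht
      have := hCM s p (Finset.mem_filter.1 hs).2
      simp only [List.mem_toFinset, List.mem_map, List.mem_filter, decide_eq_true_eq]
      exact ⟨(p, s), ⟨this, rfl⟩, rfl⟩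
    · rw [Finset.filter_eq_empty_iff.2, Finset.card_empty]
      · exact Nat.zero_le _
      · intro t _ ht
        exact hp (hmem _ _ (hCM t p ht)).1
  · refine hN.trans (le_of_eq ?_)
    rw [← sum_length_cellsOfColor]
    refine Finset.sum_congr rfl fun t _ => (List.toFinset_card_of_nodup ?_).symm
    refine (hchain t t.2).imp ?_
    rintro p q ⟨-, h⟩ rfl
    exact lt_irrefl _ h

/-! ### Duality between NE-chains and se-chains -/

theorem card_inter_le_one_of_chains {f : ℕ × ℕ → ℕ} {A C : Finset (ℕ × ℕ)} (hA : IsSeChain f A)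
    (hC : IsNEChain f C) : (C ∩ A).card ≤ 1 := by
  refine Finset.card_le_one.2 fun p hp q hq => ?_
  rw [Finset.mem_inter] at hp hq
  by_contra hpq
  have h1 := hA.2 hp.2 hq.2 hpq
  have h2 := hC.2 hp.1 hq.1 hpq
  omega

/-- A NE-chain and a se-chain have at most one cell in common; hence this bound. -/
theorem neTotal_add_seTotal_le {f : ℕ × ℕ → ℕ} {a b k l n m : ℕ} (hn : n ∈ neTotals f a b k)
    (hm : m ∈ seTotals f a b l) : n + m ≤ ∑ p ∈ cornerRect a b, f p + k * l := by
  obtain ⟨C, hC, hdisj, rfl⟩ := hn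
  obtain ⟨A, hA, hmult, rfl⟩ := hm
  set U := Finset.univ.biUnion C with hU
  have hUR : U ⊆ cornerRect a b := Finset.biUnion_subset.2 fun t _ => (hC t).2
  have h1 : ∑ t, ∑ p ∈ C t, f p = ∑ p ∈ U, f p :=
    (Finset.sum_biUnion fun s _ t _ hst => hdisj s t hst).symm
  -- The part of the se-chains inside the union `U` of the NE-chains is bounded by `k * l`, one for
  -- each pair of chains; the part outside `U` by the sum of the entries there, through the
  -- multiplicity condition.
  have h2 : ∀ s, (A s).card ≤ (U ∩ A s).card + ((cornerRect a b \ U) ∩ A s).card := by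
    intro s
    refine (Finset.card_le_card ?_).trans (Finset.card_union_le _ _)
    intro p hp
    have := (hA s).2 hp
    by_cases hpU : p ∈ U <;> simp [hp, hpU, this]
  have h3 : ∑ s, (U ∩ A s).card ≤ k * l := by
    have : ∀ s, (U ∩ A s).card ≤ k := by
      intro s
      rw [hU, Finset.biUnion_inter]
      refine Finset.card_biUnion_le.trans ?_
      refine (Finset.sum_le_sum fun t _ => card_inter_le_one_of_chains (hA s).1 (hC t).1).trans ?_
      simp
    refine (Finset.sum_le_sum fun s _ => this s).trans ?_
    simp [mul_comm]
  have h4 : ∑ s, ((cornerRect a b \ U) ∩ A s).card ≤ ∑ p ∈ cornerRect a b \ U, f p := by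
    have : ∀ s, ((cornerRect a b \ U) ∩ A s).card =
        ∑ p ∈ cornerRect a b \ U, if p ∈ A s then 1 else 0 := by
      intro s
      rw [← Finset.filter_mem_eq_inter, Finset.card_filter]
    simp only [this]
    rw [Finset.sum_comm]
    refine Finset.sum_le_sum fun p _ => ?_
    rw [← Finset.card_filter]
    exact hmult p
  have h5 := Finset.sum_sdiff (f := f) hUR
  have h6 := Finset.sum_le_sum fun s (_ : s ∈ Finset.univ) => h2 s
  rw [Finset.sum_add_distrib] at h6
  omega

/-! ### Row and column sums of a partition -/

section Partition

variable (μ : YoungDiagram) {h : ℕ}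

theorem YoungDiagram.rowLen_eq_zero_of_le (hh : μ.rowLen h = 0) {i : ℕ} (hi : h ≤ i) :
    μ.rowLen i = 0 := by
  have := μ.rowLen_anti h i hi
  omega

theorem YoungDiagram.sum_range_rowLen (hh : μ.rowLen h = 0) (k : ℕ) :
    ∑ i ∈ Finset.range k, μ.rowLen i =
      ∑ i ∈ Finset.range (h + 1), if i < k then μ.rowLen i else 0 := by
  rw [← Finset.sum_filter]
  refine (Finset.sum_subset ?_ ?_).symm
  · intro i
    simp only [Finset.mem_filter, Finset.mem_range]
    exact fun h => h.2
  · intro i hi hi'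
    simp only [Finset.mem_filter, Finset.mem_range] at hi hi'
    exact μ.rowLen_eq_zero_of_le hh (by omega)

theorem YoungDiagram.sum_range_rowLen_transpose (hh : μ.rowLen h = 0) (l : ℕ) :
    ∑ j ∈ Finset.range l, μ.transpose.rowLen j =
      ∑ i ∈ Finset.range (h + 1), min l (μ.rowLen i) := by
  have h1 : ∀ j, μ.transpose.rowLen j =
      ∑ i ∈ Finset.range (h + 1), if j < μ.rowLen i then 1 else 0 := by
    intro j
    rw [← Finset.card_filter, ← Finset.card_range (μ.transpose.rowLen j)]
    congr 1
    ext i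
    rw [Finset.mem_filter, Finset.mem_range, Finset.mem_range, ← YoungDiagram.mem_iff_lt_rowLen,
      ← YoungDiagram.mem_iff_lt_rowLen, YoungDiagram.mem_transpose]
    refine ⟨fun hi => ⟨?_, hi⟩, fun hi => hi.2⟩
    by_contra hlt
    have := YoungDiagram.mem_iff_lt_rowLen.1 hi
    change j < μ.rowLen i at this
    rw [μ.rowLen_eq_zero_of_le hh (by omega)] at this
    omega
  simp only [h1]
  rw [Finset.sum_comm]
  refine Finset.sum_congr rfl fun i _ => ?_
  rw [← Finset.card_filter, ← Finset.card_range (min l (μ.rowLen i))]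
  congr 1
  ext j
  simp

/-- The rows above `k` and the columns left of `l` cover the diagram, with overlap `k * l`. -/
theorem YoungDiagram.sum_rowLen_add_sum_transpose (hh : μ.rowLen h = 0) {k l : ℕ}
    (h1 : ∀ i < k, l ≤ μ.rowLen i) (h2 : ∀ i, k ≤ i → μ.rowLen i ≤ l) :
    ∑ i ∈ Finset.range k, μ.rowLen i + ∑ j ∈ Finset.range l, μ.transpose.rowLen j =
      ∑ i ∈ Finset.range (h + 1), μ.rowLen i + k * l := by
  have h3 : k * l = ∑ i ∈ Finset.range (h + 1), if i < k then l else 0 := by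
    rw [← Finset.sum_filter, Finset.sum_const, smul_eq_mul]
    -- For `l > 0` the `k` rows of length at least `l` all lie below the empty row `h`, so the
    -- truncated sum sees each of them.
    rcases Nat.eq_zero_or_pos l with rfl | hl
    · simp
    · have : k ≤ h := by
        by_contra hlt
        have := h1 h (by omega)
        omega
      congr 1
      rw [← Finset.card_range k]
      congr 1
      ext i
      simp only [Finset.mem_filter, Finset.mem_range, Finset.card_range]
      omega
  rw [μ.sum_range_rowLen hh, μ.sum_range_rowLen_transpose hh, h3, ← Finset.sum_add_distrib,
    ← Finset.sum_add_distrib]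
  refine Finset.sum_congr rfl fun i _ => ?_
  have := h1 i
  have := h2 i
  split_ifs <;> omega

end Partition

/-! ### Single chains and the conclusion -/

theorem neTotals_one (f : ℕ × ℕ → ℕ) (a b : ℕ) : neTotals f a b 1 =
    {n | ∃ C : Finset (ℕ × ℕ), IsNEChain f C ∧ C ⊆ cornerRect a b ∧ n = ∑ p ∈ C, f p} := by
  ext n
  constructor
  · rintro ⟨C, hC, -, rfl⟩
    exact ⟨C 0, (hC 0).1, (hC 0).2, by simp⟩
  · rintro ⟨C, hC, hCR, rfl⟩
    exact ⟨fun _ => C, fun _ => ⟨hC, hCR⟩, fun s t hst => absurd (Subsingleton.elim s t) hst,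
      by simp⟩

theorem seTotals_one (f : ℕ × ℕ → ℕ) (a b : ℕ) : seTotals f a b 1 =
    {n | ∃ C : Finset (ℕ × ℕ), IsSeChain f C ∧ C ⊆ cornerRect a b ∧ n = C.card} := by
  ext n
  constructor
  · rintro ⟨C, hC, -, rfl⟩
    exact ⟨C 0, (hC 0).1, (hC 0).2, by simp⟩
  · rintro ⟨C, hC, hCR, rfl⟩
    refine ⟨fun _ => C, fun _ => ⟨hC, hCR⟩, fun p => ?_, by simp⟩
    by_cases hp : p ∈ C
    · simpa [hp] using Nat.one_le_iff_ne_zero.2 (hC.1 p hp)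
    · simp [hp]

theorem theorem8 (F : YoungDiagram) (f : ℕ × ℕ → ℕ) (Λ : ℕ → ℕ → YoungDiagram)
    (hΛ : IsRSKDiagram F f Λ) (a b : ℕ) (hc : IsShapeCorner F a b) :
    (∀ k : ℕ, IsGreatest (neTotals f a b k) (∑ i ∈ Finset.range k, (Λ a b).rowLen i)) ∧
    (∀ k : ℕ, IsGreatest (seTotals f a b k)
      (∑ i ∈ Finset.range k, (Λ a b).transpose.rowLen i)) ∧
    IsGreatest {n | ∃ C : Finset (ℕ × ℕ), IsNEChain f C ∧ C ⊆ cornerRect a b ∧ n = ∑ p ∈ C, f p}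
      ((Λ a b).rowLen 0) ∧
    IsGreatest {n | ∃ C : Finset (ℕ × ℕ), IsSeChain f C ∧ C ⊆ cornerRect a b ∧ n = C.card}
      ((Λ a b).transpose.rowLen 0) := by
  obtain ⟨h, hh⟩ : ∃ h, (Λ a b).rowLen h = 0 := by
    refine ⟨(Λ a b).colLen 0, ?_⟩
    by_contra hne
    have h1 := YoungDiagram.mem_iff_lt_rowLen.2 (Nat.pos_of_ne_zero hne)
    exact lt_irrefl _ (YoungDiagram.mem_iff_lt_colLen.1 h1)
  have hne : ∀ k, ∃ n ∈ neTotals f a b k, ∑ i ∈ Finset.range k, (Λ a b).rowLen i ≤ n := by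
    intro k
    rw [YoungDiagram.sum_range_rowLen _ hh]
    exact (hΛ.hasChains_le hc hh k).exists_neTotal
  have hse : ∀ l, ∃ m ∈ seTotals f a b l,
      ∑ j ∈ Finset.range l, (Λ a b).transpose.rowLen j ≤ m := by
    intro l
    rw [YoungDiagram.sum_range_rowLen_transpose _ hh]
    exact (hΛ.hasChains_gt hc hh l).exists_seTotal
  have hsum := hΛ.sum_rowLen hc hh
  have hNE : ∀ k, IsGreatest (neTotals f a b k) (∑ i ∈ Finset.range k, (Λ a b).rowLen i) := by
    intro k
    have hle : ∀ n ∈ neTotals f a b k, n ≤ ∑ i ∈ Finset.range k, (Λ a b).rowLen i := by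
      intro n hn
      -- With `l = λ_{k+1}`, the first `k` rows have length at least `l` and the others at most `l`,
      -- so the duality bound is tight.
      obtain ⟨m, hm, hm'⟩ := hse ((Λ a b).rowLen k)
      have h1 := neTotal_add_seTotal_le hn hm
      have h2 := (Λ a b).sum_rowLen_add_sum_transpose hh (k := k) (l := (Λ a b).rowLen k)
        (fun i hi => (Λ a b).rowLen_anti _ _ hi.le) (fun i hi => (Λ a b).rowLen_anti _ _ hi)
      omega
    obtain ⟨n, hn, hn'⟩ := hne k
    exact ⟨le_antisymm (hle n hn) hn' ▸ hn, hle⟩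
  have hSE : ∀ l, IsGreatest (seTotals f a b l)
      (∑ j ∈ Finset.range l, (Λ a b).transpose.rowLen j) := by
    intro l
    have hle : ∀ m ∈ seTotals f a b l, m ≤ ∑ j ∈ Finset.range l, (Λ a b).transpose.rowLen j := by
      intro m hm
      have hmem : ∀ i, i < (Λ a b).colLen l ↔ l < (Λ a b).rowLen i := fun i => by
        rw [← YoungDiagram.mem_iff_lt_colLen, ← YoungDiagram.mem_iff_lt_rowLen]
      -- Dually, `k = λ'_{l+1}` is the number of rows longer than `l`.
      obtain ⟨n, hn, hn'⟩ := hne ((Λ a b).colLen l)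
      have h1 := neTotal_add_seTotal_le hn hm
      have h2 := (Λ a b).sum_rowLen_add_sum_transpose hh (k := (Λ a b).colLen l) (l := l)
        (fun i hi => ((hmem i).1 hi).le)
        (fun i hi => not_lt.1 fun hlt => absurd ((hmem i).2 hlt) hi.not_gt)
      omega
    obtain ⟨m, hm, hm'⟩ := hse l
    exact ⟨le_antisymm (hle m hm) hm' ▸ hm, hle⟩
  refine ⟨hNE, hSE, ?_, ?_⟩
  · simpa [neTotals_one] using hNE 1
  · simpa [seTotals_one] using hSE 1
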